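/- All graphs are finite, simple and undirected. Let $G$ be a connected graph of order $n\ge 2$. For an edge-coloring of $G$ (adjacent edges may have the same color) and distinct vertices $u,v$, a $u$-$v$-rainbow-cut is a set $R$ of edges with pairwise different colors such that $u$ and $v$ lie in different components of $G-R$. The rainbow disconnection number $\mathrm{rd}(G)$ is the smallest number of colors in an edge-coloring of $G$ for which every two distinct vertices $u,v$ have a $u$-$v$-rainbow-cut. Write $N(v)$ for the open neighborhood of $v$, $N[v]=N(v)\cup\{v\}$, and $\Delta(G)$ for the maximum degree. Then $\mathrm{rd}(G)=n-2$ if and only if one of the following conditions holds. (i) $G$ has exactly one vertex of degree $n-1$, and at least one vertex of degree $n-2$. (ii) $\Delta(G)=n-2$, and there exist two distinct nonadjacent vertices of degree $n-2$. (iii) $\Delta(G)=n-2$, any two distinct vertices of degree $n-2$ are adjacent, and at least one of the following holds: (a) there are two distinct vertices $u,v$ of degree $n-2$ and a vertex $z$ with $z\notin N(u)\cup N(v)$; (b) there are two distinct vertices $u,v$ of degree $n-2$ and two distinct vertices $x\in N(u)\setminus N[v]$ and $y\in N(v)\setminus N[u]$ such that $x$ and $y$ belong to the same component of the induced subgraph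 $G[V(G)\setminus\{u,v\}]$. -/

import Mathlib

namespace SimpleGraph

/-- The closed neighbourhood `N[v]` of a vertex. -/
def closedNeighborSet {V : Type*} (G : SimpleGraph V) (v : V) : Set V :=
  insert v (G.neighborSet v)

/-- `R` is a `u`-`v`-rainbow-cut for the edge-colouring `c`: no two edges of `R` have the same
colour, and `u` and `v` belong to different components of `G - R`. -/
def IsRainbowCut {V : Type*} (G : SimpleGraph V) {K : Type*} (c : G.edgeSet → K)
    (u v : V) (R : Set G.edgeSet) : Prop :=
  Set.InjOn c R ∧ ¬ (G.deleteEdges (Subtype.val '' R)).Reachable u v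

/-- `c` is a rainbow disconnection colouring of `G`: any two distinct vertices are separated by
a rainbow-cut. -/
def IsRainbowDisconnected {V : Type*} (G : SimpleGraph V) {K : Type*} (c : G.edgeSet → K) :
    Prop :=
  ∀ u v : V, u ≠ v → ∃ R : Set G.edgeSet, G.IsRainbowCut c u v R

/-- The rainbow disconnection number `rd(G)`: the smallest `k` such that `G` has a rainbow
disconnection colouring with colours from a set of `k` colours. -/
noncomputable def rd {V : Type*} (G : SimpleGraph V) : ℕ :=
  sInf {k : ℕ | ∃ c : G.edgeSet → Fin k, G.IsRainbowDisconnected c}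

/-- For a finite graph the set of numbers defining `rd(G)` is nonempty, so that `rd(G)` is a
genuine minimum. -/
theorem exists_isRainbowDisconnected {V : Type*} [Finite V] (G : SimpleGraph V) :
    ∃ c : G.edgeSet → Fin G.rd, G.IsRainbowDisconnected c := by
  refine Nat.sInf_mem (s := {k : ℕ | ∃ c : G.edgeSet → Fin k, G.IsRainbowDisconnected c})
    ⟨Nat.card G.edgeSet, ?_⟩
  refine ⟨Finite.equivFin G.edgeSet, fun u v huv => ⟨Set.univ, ?_, ?_⟩⟩
  · exact (Finite.equivFin G.edgeSet).injective.injOn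
  · have h : G.deleteEdges (Subtype.val '' (Set.univ : Set G.edgeSet)) = ⊥ := by
      ext a b
      simp
    rw [h, reachable_bot]
    exact huv

end SimpleGraph

/-!
Let `n` be the order of `G`.

**Lower bounds.** For distinct `u` and `v` and a rainbow cut between them, let `S` be the component
of `u` after the removal of the cut. Each vertex `w` of `N(u) ∩ N[v]` contributes the edge `wv` or
`uw` to the edges between `S` and its complement, according to whether `w ∈ S`, and these edges are
distinct (`exists_cut_of_card_inter_le_rd`). So `rd G ≥ n - 1` if there are two vertices of degree
`n - 1`, and under each of the stated conditions there are `u` and `v` that give `rd G ≥ n - 2`; in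
the last one, a path from `u` to `v` through `x` and `y` accounts for one further edge
(`degree_le_rd_of_reachable`).

**Upper bounds.** A vertex at which the colouring is proper is cut off from all others by the edges
at it. So it suffices that the colouring is proper at all vertices but one, `v` say, and for this one
colours `G - v` properly and then gives each edge at `v` a colour missing at its other end. If `v`
has maximum degree, all other degrees are at most `k`, and `n ≤ k + 3`, then at most two vertices
have degree `k` in `G - v`, and a form of Vizing's theorem (`exists_isEdgeColoring_range`) colours
`G - v` with `k` colours; hence `rd G ≤ k` (`Connected.rd_le_of_degree_le`). With `k = n - 2` this
covers all graphs with at most one vertex of degree `n - 1`. With `k = n - 3` it leaves, outside the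
stated conditions, only the case of two adjacent vertices `u` and `v` of degree `n - 2` whose
non-neighbours lie in different components of `G - {u, v}`. There `G` has a cut of `n - 3` edges
between `u` and `v`, all of them at `u` or `v`; turning those other than `uv` into edges at a single
vertex and deleting the remaining edges at `u` and `v` gives a graph with degrees below `n - 3`, and
from a proper colouring of it one obtains a colouring of `G` that is proper outside `{u, v}` and
rainbow on the cut (`rd_le_of_separating_set`).

**Vizing's theorem** is proved by adding a vertex `v` to a coloured graph: two missing colours are
reserved at each neighbour of `v`, only one at a single exceptional neighbour, and by exchanges along
two-coloured components some colour becomes reserved exactly once. It is used at the vertex reserving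
it, and induction applies to the rest (`IsReserved.exists_injOn_missing`).
-/

section

open Finset

namespace SimpleGraph

variable {V : Type*}

/-! ### Proper edge-colourings and exchanges of two colours -/

/-- `c` is a proper edge-colouring of `H` with colours from `K`. The colouring is a function on all
unordered pairs, whose values off the edges of `H` are irrelevant; this allows it to be changed and
extended without transport between edge sets. -/
structure IsEdgeColoring (H : SimpleGraph V) (K : Finset ℕ) (c : Sym2 V → ℕ) : Prop where
  mem : ∀ ⦃x y⦄, H.Adj x y → c s(x, y) ∈ K
  inj : ∀ ⦃x y z⦄, H.Adj x y → H.Adj x z → c s(x, y) = c s(x, z) → y = z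

/-- No edge of `H` at `x` has colour `i`. -/
def IsMissing (H : SimpleGraph V) (c : Sym2 V → ℕ) (x : V) (i : ℕ) : Prop :=
  ∀ ⦃y⦄, H.Adj x y → c s(x, y) ≠ i

/-- The subgraph of `H` formed by the edges of colour `i` or `j`. -/
def kempeGraph (H : SimpleGraph V) (c : Sym2 V → ℕ) (i j : ℕ) : SimpleGraph V where
  Adj x y := H.Adj x y ∧ (c s(x, y) = i ∨ c s(x, y) = j)
  symm := ⟨fun x y h => by rw [Sym2.eq_swap]; exact ⟨h.1.symm, h.2⟩⟩
  loopless := ⟨fun x h => H.loopless.irrefl x h.1⟩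

/-- A connected graph has at least `n - 1` edges, so if its degrees are at most two, then at most
two of them are at most one. -/
lemma Connected.card_le_two_of_degree_le {W : Type*} [Fintype W] {F : SimpleGraph W}
    [DecidableRel F.Adj] (hF : F.Connected) (h2 : ∀ x, F.degree x ≤ 2) (S : Finset W)
    (hS : ∀ x ∈ S, F.degree x ≤ 1) : #S ≤ 2 := by
  classical
  have h1 := hF.card_vert_le_card_edgeSet_add_one
  rw [Nat.card_eq_fintype_card, Nat.card_eq_fintype_card, ← edgeFinset_card] at h1
  have hsum := F.sum_degrees_eq_twice_card_edges
  have hle : ∑ x, (F.degree x + if x ∈ S then 1 else 0) ≤ ∑ _x : W, 2 := by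
    refine sum_le_sum fun x _ => ?_
    split_ifs with h
    · have := hS x h
      omega
    · exact h2 x
  rw [sum_add_distrib, hsum] at hle
  simp only [sum_const, card_univ, smul_eq_mul, sum_boole, filter_mem_eq_inter, univ_inter,
    Nat.cast_id] at hle
  omega

/-- A component of the graph of two colours is a path or a cycle, so it has at most two vertices
that miss one given colour of the two. -/
lemma IsEdgeColoring.card_missing_le_two [Fintype V] {H : SimpleGraph V} {K : Finset ℕ}
    {c : Sym2 V → ℕ} (hc : H.IsEdgeColoring K c) (i j : ℕ) (w : V) (S : Finset V)
    (hS : ∀ x ∈ S, (H.kempeGraph c i j).Reachable w x) (hj : ∀ x ∈ S, H.IsMissing c x j) :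
    #S ≤ 2 := by
  classical
  set F := H.kempeGraph c i j
  let C := F.connectedComponentMk w
  have hF : C.toSimpleGraph.Connected := C.connected_toSimpleGraph
  have hmaps : ∀ x : C, Set.InjOn (fun y : C => c s((x : V), (y : V)))
      (C.toSimpleGraph.neighborFinset x) := by
    intro x y hy z hz h
    simp only [coe_neighborFinset, mem_neighborSet] at hy hz
    exact Subtype.ext (hc.inj (show F.Adj x y from hy).1 (show F.Adj x z from hz).1 h)
  have hSC : ∀ x ∈ S, x ∈ C.supp := fun x hx => ConnectedComponent.sound (hS x hx).symm
  have hcard : #(S.subtype (· ∈ C.supp)) = #S := by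
    rw [card_subtype, filter_true_of_mem hSC]
  rw [← hcard]
  refine hF.card_le_two_of_degree_le (fun x => ?_) _ (fun x hx => ?_)
  · refine (card_le_card_of_injOn (t := {i, j}) _ (fun y hy => ?_) (hmaps x)).trans card_le_two
    simp only [coe_neighborFinset, mem_neighborSet] at hy
    simpa using (show F.Adj x y from hy).2
  · refine (card_le_card_of_injOn (t := {i}) _ (fun y hy => ?_) (hmaps x)).trans (by simp)
    simp only [coe_neighborFinset, mem_neighborSet] at hy
    have hxy : F.Adj x y := hy
    simpa using hxy.2.resolve_right (hj x (by simpa using hx) hxy.1)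

/-- Exchanging two colours on a union `C` of components of the graph of these colours. Seen from a
vertex, the exchange is a permutation of the colours. -/
lemma IsEdgeColoring.exists_swap {H : SimpleGraph V} {K : Finset ℕ} {c : Sym2 V → ℕ}
    (hc : H.IsEdgeColoring K c) {i j : ℕ} (hi : i ∈ K) (hj : j ∈ K) (C : Set V)
    [DecidablePred (· ∈ C)] (hC : ∀ x y, (H.kempeGraph c i j).Adj x y → x ∈ C → y ∈ C) :
    ∃ c', H.IsEdgeColoring K c' ∧ ∀ x y, H.Adj x y →
      c' s(x, y) = if x ∈ C then Equiv.swap i j (c s(x, y)) else c s(x, y) := by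
  classical
  have key : ∀ x y, H.Adj x y →
      (if ∃ z ∈ s(x, y), z ∈ C then Equiv.swap i j (c s(x, y)) else c s(x, y)) =
        if x ∈ C then Equiv.swap i j (c s(x, y)) else c s(x, y) := by
    intro x y hxy
    by_cases hx : x ∈ C
    · rw [if_pos ⟨x, Sym2.mem_mk_left x y, hx⟩, if_pos hx]
    · rw [if_neg hx]
      split_ifs with h
      · have hy : y ∈ C := by
          obtain ⟨z, hz, hzC⟩ := h
          rcases Sym2.mem_iff.1 hz with rfl | rfl
          · exact absurd hzC hx
          · exact hzC
        have hn : ¬ (c s(x, y) = i ∨ c s(x, y) = j) := by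
          intro h'
          refine hx (hC y x ⟨hxy.symm, ?_⟩ hy)
          rwa [Sym2.eq_swap]
        push Not at hn
        exact Equiv.swap_apply_of_ne_of_ne hn.1 hn.2
      · rfl
  have hK : ∀ a ∈ K, Equiv.swap i j a ∈ K := by
    intro a ha
    rw [Equiv.swap_apply_def]
    split_ifs <;> assumption
  refine ⟨fun e => if ∃ z ∈ e, z ∈ C then Equiv.swap i j (c e) else c e, ⟨?_, ?_⟩, key⟩
  · intro x y hxy
    rw [key x y hxy]
    split_ifs
    · exact hK _ (hc.mem hxy)
    · exact hc.mem hxy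
  · intro x y z hxy hxz h
    rw [key x y hxy, key x z hxz] at h
    refine hc.inj hxy hxz ?_
    split_ifs at h
    · exact (Equiv.swap i j).injective h
    · exact h

/-! ### Reserving missing colours -/

/-- `c` is a proper edge-colouring of `H` with colours from `K`, and `M` assigns to each vertex
of `N` a set of colours from `K` that are missing there. -/
structure IsReserved (H : SimpleGraph V) (K : Finset ℕ) (N : Finset V) (c : Sym2 V → ℕ)
    (M : V → Finset ℕ) : Prop where
  coloring : H.IsEdgeColoring K c
  subset : ∀ w ∈ N, M w ⊆ K
  missing : ∀ w ∈ N, ∀ i ∈ M w, H.IsMissing c w i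

/-- If colour `i` is reserved nowhere and colour `j` at three or more vertices, then exchanging the
colours on the component of one of these vertices moves one or two reservations from `j` to `i`,
which lowers the sum of the squares of the numbers of reservations. -/
lemma IsReserved.exists_sum_sq_lt [Fintype V] [DecidableEq V] {H : SimpleGraph V} {K : Finset ℕ}
    {N : Finset V} {c : Sym2 V → ℕ} {M : V → Finset ℕ} (h : H.IsReserved K N c M) {i j : ℕ}
    (hi : i ∈ K) (hj : j ∈ K) (hi0 : #{w ∈ N | i ∈ M w} = 0) (hj3 : 3 ≤ #{w ∈ N | j ∈ M w}) :
    ∃ c' M', H.IsReserved K N c' M' ∧ (∀ w ∈ N, #(M' w) = #(M w)) ∧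
      ∑ l ∈ K, #{w ∈ N | l ∈ M' w} ^ 2 < ∑ l ∈ K, #{w ∈ N | l ∈ M w} ^ 2 := by
  classical
  have hij : i ≠ j := by
    rintro rfl
    omega
  obtain ⟨w, hw⟩ : {w ∈ N | j ∈ M w}.Nonempty := card_pos.1 (by omega)
  let C : Set V := {x | (H.kempeGraph c i j).Reachable w x}
  obtain ⟨c', hc', hcc'⟩ := h.coloring.exists_swap hi hj C
    (fun x y hxy (hx : (H.kempeGraph c i j).Reachable w x) => hx.trans hxy.reachable)
  let M' : V → Finset ℕ := fun x => if x ∈ C then (M x).map (Equiv.swap i j).toEmbedding else M x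
  have hM' : ∀ x l, l ∈ M' x ↔ (if x ∈ C then Equiv.swap i j l ∈ M x else l ∈ M x) := by
    intro x l
    simp only [M']
    split_ifs
    · rw [mem_map_equiv, Equiv.symm_swap]
    · rfl
  have hni : ∀ x ∈ N, i ∉ M x := by
    intro x hx hix
    rw [card_eq_zero, filter_eq_empty_iff] at hi0
    exact hi0 hx hix
  refine ⟨c', M', ⟨hc', ?_, ?_⟩, ?_, ?_⟩
  · intro x hx l hl
    rw [hM'] at hl
    split_ifs at hl
    · have h1 := h.subset x hx hl
      rw [Equiv.swap_apply_def] at h1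
      split_ifs at h1 with h2 h3
      · exact h2 ▸ hi
      · exact h3 ▸ hj
      · exact h1
    · exact h.subset x hx hl
  · intro x hx l hl y hxy hl'
    rw [hM'] at hl
    rw [hcc' x y hxy] at hl'
    split_ifs at hl hl'
    · refine h.missing x hx _ hl hxy ?_
      rw [← hl', Equiv.swap_apply_self]
    · exact h.missing x hx _ hl hxy hl'
  · intro x _
    simp only [M']
    split_ifs
    · exact card_map _
    · rfl
  · have hother : ∀ l, l ≠ i → l ≠ j → #{w ∈ N | l ∈ M' w} = #{w ∈ N | l ∈ M w} := by
      intro l hli hlj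
      congr 1
      refine filter_congr fun x _ => ?_
      rw [hM', Equiv.swap_apply_of_ne_of_ne hli hlj, ite_self]
    have hnewi : {w ∈ N | i ∈ M' w} = {w ∈ {w ∈ N | j ∈ M w} | w ∈ C} := by
      ext x
      simp only [mem_filter, hM', Equiv.swap_apply_left]
      by_cases hx : x ∈ N
      · have := hni x hx
        split_ifs <;> simp_all
      · simp [hx]
    have hnewj : {w ∈ N | j ∈ M' w} = {w ∈ {w ∈ N | j ∈ M w} | w ∉ C} := by
      ext x
      simp only [mem_filter, hM', Equiv.swap_apply_right]
      by_cases hx : x ∈ N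
      · have := hni x hx
        split_ifs <;> simp_all
      · simp [hx]
    have hadd := card_filter_add_card_filter_not (s := {w ∈ N | j ∈ M w}) (· ∈ C)
    rw [← hnewi, ← hnewj] at hadd
    have hle : #{w ∈ N | i ∈ M' w} ≤ 2 := by
      rw [hnewi]
      refine h.coloring.card_missing_le_two i j w _ (fun x hx => (mem_filter.1 hx).2) ?_
      intro x hx
      have hx' := mem_filter.1 (mem_filter.1 hx).1
      exact h.missing x hx'.1 j hx'.2
    have hpos : 0 < #{w ∈ N | i ∈ M' w} := by
      rw [hnewi]
      exact card_pos.2 ⟨w, mem_filter.2 ⟨hw, Reachable.refl w⟩⟩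
    have hjK : j ∈ K.erase i := mem_erase.2 ⟨hij.symm, hj⟩
    rw [← add_sum_erase K _ hi, ← add_sum_erase K _ hi, ← add_sum_erase _ _ hjK,
      ← add_sum_erase _ _ hjK, hi0]
    have hrest : ∑ l ∈ (K.erase i).erase j, #{w ∈ N | l ∈ M' w} ^ 2 =
        ∑ l ∈ (K.erase i).erase j, #{w ∈ N | l ∈ M w} ^ 2 := by
      refine sum_congr rfl fun l hl => ?_
      rw [mem_erase, mem_erase] at hl
      rw [hother l hl.2.1 hl.1]
    rw [hrest]
    generalize #{w ∈ N | i ∈ M' w} = p at *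
    generalize #{w ∈ N | j ∈ M' w} = q at *
    generalize #{w ∈ N | j ∈ M w} = r at *
    subst hadd
    have : p ^ 2 + q ^ 2 < (p + q) ^ 2 := by nlinarith
    omega

/-- If one vertex of `N` reserves one colour and every other vertex two, then the total number of
reservations is odd and less than twice the number of colours; so once the sum of squares is
minimal, some colour is reserved exactly once. -/
lemma IsReserved.exists_card_eq_one [Fintype V] [DecidableEq V] {H : SimpleGraph V} {K : Finset ℕ}
    {N : Finset V} {c₀ : Sym2 V → ℕ} {M₀ : V → Finset ℕ} (h₀ : H.IsReserved K N c₀ M₀) {w₀ : V}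
    (hw₀ : w₀ ∈ N) (hNK : #N ≤ #K) (hM₀ : ∀ w ∈ N, #(M₀ w) = if w = w₀ then 1 else 2) :
    ∃ c M, H.IsReserved K N c M ∧ (∀ w ∈ N, #(M w) = if w = w₀ then 1 else 2) ∧
      ∃ i ∈ K, #{w ∈ N | i ∈ M w} = 1 := by
  classical
  let P : (Sym2 V → ℕ) × (V → Finset ℕ) → Prop := fun p =>
    H.IsReserved K N p.1 p.2 ∧ ∀ w ∈ N, #(p.2 w) = if w = w₀ then 1 else 2
  let μ : (Sym2 V → ℕ) × (V → Finset ℕ) → ℕ := fun p => ∑ l ∈ K, #{w ∈ N | l ∈ p.2 w} ^ 2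
  obtain ⟨⟨c, M⟩, ⟨h, hM⟩, hmin⟩ : ∃ p, P p ∧ ∀ q, P q → μ p ≤ μ q := by
    obtain ⟨p, hp, hmin⟩ := WellFounded.has_min (measure μ).wf {p | P p} ⟨(c₀, M₀), h₀, hM₀⟩
    exact ⟨p, hp, fun q hq => not_lt.1 (hmin q hq)⟩
  refine ⟨c, M, h, hM, ?_⟩
  by_contra! hne
  have hsum : ∑ l ∈ K, #{w ∈ N | l ∈ M w} + 1 = 2 * #N := by
    have h1 := sum_card_bipartiteAbove_eq_sum_card_bipartiteBelow (s := K) (t := N)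
      (fun l w => l ∈ M w)
    simp only [bipartiteAbove, bipartiteBelow] at h1
    rw [h1]
    have h2 : ∀ w ∈ N, #{l ∈ K | l ∈ M w} = if w = w₀ then 1 else 2 := by
      intro w hw
      rw [← hM w hw, filter_mem_eq_inter, inter_eq_right.2 (h.subset w hw)]
    rw [sum_congr rfl h2, ← add_sum_erase N _ hw₀, if_pos rfl,
      sum_congr rfl (g := fun _ => 2) (fun x hx => if_neg (mem_erase.1 hx).1), sum_const,
      smul_eq_mul, card_erase_of_mem hw₀]
    have := card_pos.2 ⟨w₀, hw₀⟩
    omega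
  by_cases h0 : ∃ i ∈ K, #{w ∈ N | i ∈ M w} = 0
  · obtain ⟨i, hi, hi0⟩ := h0
    have heven : Even (∑ l ∈ K, #{w ∈ N | l ∈ M w}) := by
      refine Finset.sum_induction _ Even (fun _ _ => Even.add) Even.zero fun j hj => ?_
      have hj2 : #{w ∈ N | j ∈ M w} ≤ 2 := by
        by_contra! hj3
        obtain ⟨c', M', h', hM', hlt⟩ := h.exists_sum_sq_lt hi hj hi0 hj3
        exact absurd hlt (not_lt.2 (hmin (c', M') ⟨h', fun w hw => (hM' w hw).trans (hM w hw)⟩))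
      have := hne j hj
      rw [Nat.even_iff]
      omega
    rw [Nat.even_iff] at heven
    omega
  · push Not at h0
    have : ∑ _l ∈ K, 2 ≤ ∑ l ∈ K, #{w ∈ N | l ∈ M w} := by
      refine sum_le_sum fun l hl => ?_
      have := hne l hl
      have := h0 l hl
      omega
    rw [sum_const, smul_eq_mul] at this
    omega

/-- The colouring can be changed so that different colours missing at the vertices of `N` can be
chosen. By induction on the size of `N`: a colour reserved exactly once is given to the vertex
reserving it, and then this vertex and all edges of this colour are set aside. -/
lemma IsReserved.exists_injOn_missing [Fintype V] {K : Finset ℕ} {N : Finset V} {w₀ : V}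
    {H : SimpleGraph V} {c : Sym2 V → ℕ} {M : V → Finset ℕ} (h : H.IsReserved K N c M)
    (hNK : #N ≤ #K) (h1 : ∀ w ∈ N, 1 ≤ #(M w)) (h2 : ∀ w ∈ N, w ≠ w₀ → 2 ≤ #(M w)) :
    ∃ c' f, H.IsEdgeColoring K c' ∧ Set.InjOn f N ∧ ∀ w ∈ N, f w ∈ K ∧ H.IsMissing c' w (f w) := by
  classical
  induction hm : #N generalizing K N w₀ H c M with
  | zero =>
    rw [card_eq_zero] at hm
    subst hm
    exact ⟨c, fun _ => 0, h.coloring, by simp, by simp⟩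
  | succ m ih =>
    obtain ⟨w₁, hw₁, hw₁'⟩ : ∃ w₁ ∈ N, ∀ w ∈ N, w ≠ w₁ → w ≠ w₀ := by
      by_cases hw : w₀ ∈ N
      · exact ⟨w₀, hw, fun _ _ h => h⟩
      · obtain ⟨w₁, hw₁⟩ : N.Nonempty := card_pos.1 (by omega)
        exact ⟨w₁, hw₁, fun w hwN _ h => hw (h ▸ hwN)⟩
    -- Reservations in excess are dropped to make their number odd.
    have hsub : ∀ w, ∃ s, w ∈ N → s ⊆ M w ∧ #s = if w = w₁ then 1 else 2 := by
      intro w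
      by_cases hw : w ∈ N
      · have : (if w = w₁ then 1 else 2) ≤ #(M w) := by
          split_ifs with hww
          · exact h1 w hw
          · exact h2 w hw (hw₁' w hw hww)
        obtain ⟨s, hs⟩ := exists_subset_card_eq this
        exact ⟨s, fun _ => hs⟩
      · exact ⟨∅, fun h => absurd h hw⟩
    choose M₁ hM₁ using hsub
    have hres : H.IsReserved K N c M₁ :=
      ⟨h.coloring, fun w hw => (hM₁ w hw).1.trans (h.subset w hw),
        fun w hw i hi => h.missing w hw i ((hM₁ w hw).1 hi)⟩
    obtain ⟨c₂, M₂, h₂, hM₂, i, hi, hi1⟩ :=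
      hres.exists_card_eq_one hw₁ hNK (fun w hw => (hM₁ w hw).2)
    obtain ⟨w₂, hw₂⟩ := card_eq_one.1 hi1
    have hmem : ∀ w, w ∈ N ∧ i ∈ M₂ w ↔ w = w₂ := by
      intro w
      rw [← mem_singleton, ← hw₂, mem_filter]
    have hw₂N := (hmem w₂).2 rfl
    -- In what remains, colour `i` no longer occurs.
    let H' : SimpleGraph V := H.deleteEdges {e | c₂ e = i}
    have hadj : ∀ x y, H'.Adj x y ↔ H.Adj x y ∧ c₂ s(x, y) ≠ i := fun x y => deleteEdges_adj
    have h' : H'.IsReserved (K.erase i) (N.erase w₂) c₂ M₂ := by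
      refine ⟨⟨fun x y hxy => ?_, fun x y z hxy hxz => ?_⟩, fun w hw l hl => ?_,
        fun w hw l hl y hxy => ?_⟩
      · rw [hadj] at hxy
        exact mem_erase.2 ⟨hxy.2, h₂.coloring.mem hxy.1⟩
      · rw [hadj] at hxy hxz
        exact h₂.coloring.inj hxy.1 hxz.1
      · rw [mem_erase] at hw ⊢
        refine ⟨?_, h₂.subset w hw.2 hl⟩
        rintro rfl
        exact hw.1 ((hmem w).1 ⟨hw.2, hl⟩)
      · exact h₂.missing w (mem_erase.1 hw).2 l hl ((hadj _ _).1 hxy).1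
    obtain ⟨c', f, hc', hf, hfm⟩ := ih (w₀ := w₁) h'
      (by rw [card_erase_of_mem hw₂N.1, card_erase_of_mem hi]; omega)
      (fun w hw => by rw [hM₂ w (mem_erase.1 hw).2]; split_ifs <;> omega)
      (fun w hw hww => by rw [hM₂ w (mem_erase.1 hw).2, if_neg hww])
      (by rw [card_erase_of_mem hw₂N.1]; omega)
    let c'' : Sym2 V → ℕ := fun e => if c₂ e = i then i else c' e
    have hne : ∀ x y, H.Adj x y → c₂ s(x, y) ≠ i → c' s(x, y) ≠ i := fun x y hxy hxi =>
      (mem_erase.1 (hc'.mem ((hadj x y).2 ⟨hxy, hxi⟩))).1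
    refine ⟨c'', fun w => if w = w₂ then i else f w, ⟨fun x y hxy => ?_, fun x y z hxy hxz hyz => ?_⟩,
      ?_, ?_⟩
    · simp only [c'']
      split_ifs with hxi
      · exact hi
      · exact (mem_erase.1 (hc'.mem ((hadj x y).2 ⟨hxy, hxi⟩))).2
    · simp only [c''] at hyz
      split_ifs at hyz with hy hz hz
      · exact h₂.coloring.inj hxy hxz (hy.trans hz.symm)
      · exact absurd hyz.symm (hne x z hxz hz)
      · exact absurd hyz (hne x y hxy hy)
      · exact hc'.inj ((hadj x y).2 ⟨hxy, hy⟩) ((hadj x z).2 ⟨hxz, hz⟩) hyz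
    · intro x hx y hy hxy
      have hfi : ∀ x ∈ N, x ≠ w₂ → f x ≠ i := fun x hx hxw =>
        (mem_erase.1 (hfm x (mem_erase.2 ⟨hxw, hx⟩)).1).1
      simp only at hxy
      split_ifs at hxy with hxw hyw hyw
      · rw [hxw, hyw]
      · exact absurd hxy.symm (hfi y hy hyw)
      · exact absurd hxy (hfi x hx hxw)
      · exact hf (mem_coe.2 (mem_erase.2 ⟨hxw, hx⟩)) (mem_coe.2 (mem_erase.2 ⟨hyw, hy⟩)) hxy
    · intro w hw
      simp only
      split_ifs with hww
      · subst hww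
        refine ⟨hi, fun y hxy => ?_⟩
        have h3 := h₂.missing w hw i hw₂N.2 hxy
        simp only [c'', if_neg h3]
        exact hne w y hxy h3
      · have h3 := hfm w (mem_erase.2 ⟨hww, hw⟩)
        refine ⟨(mem_erase.1 h3.1).2, fun y hxy => ?_⟩
        simp only [c'']
        split_ifs with hyi
        · exact (mem_erase.1 h3.1).1.symm
        · exact h3.2 ((hadj w y).2 ⟨hxy, hyi⟩)

/-! ### Patching colourings -/

/-- The colouring that agrees with `c` on pairs outside `B`, has the value `l` on pairs inside `B`,
and gives the colour `T p q` to the pair of `p ∈ B` and `q ∉ B`. -/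
noncomputable def patch (B : Set V) (l : ℕ) (T : V → V → ℕ) (c : Sym2 V → ℕ) : Sym2 V → ℕ :=
  open Classical in
  Sym2.lift ⟨fun p q => if p ∈ B then (if q ∈ B then l else T p q) else
    if q ∈ B then T q p else c s(p, q), fun p q => by
      have h : c s(p, q) = c s(q, p) := by rw [Sym2.eq_swap]
      dsimp only
      split_ifs <;> first | rfl | exact h⟩

section patch

variable {B : Set V} {l : ℕ} {T : V → V → ℕ} {c : Sym2 V → ℕ} {p q : V}

lemma patch_of_mem_of_mem (hp : p ∈ B) (hq : q ∈ B) : patch B l T c s(p, q) = l := by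
  simp [patch, hp, hq]

lemma patch_of_mem_of_notMem (hp : p ∈ B) (hq : q ∉ B) : patch B l T c s(p, q) = T p q := by
  simp [patch, hp, hq]

lemma patch_of_notMem_of_mem (hp : p ∉ B) (hq : q ∈ B) : patch B l T c s(p, q) = T q p := by
  simp [patch, hp, hq]

lemma patch_of_notMem_of_notMem (hp : p ∉ B) (hq : q ∉ B) :
    patch B l T c s(p, q) = c s(p, q) := by
  simp [patch, hp, hq]

end patch

/-! ### A form of Vizing's theorem -/

lemma card_le_card_missing_add_degree [Fintype V] {H : SimpleGraph V}
    [DecidableRel H.Adj] {K : Finset ℕ} {c : Sym2 V → ℕ} (x : V)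
    [DecidablePred (H.IsMissing c x)] : #K ≤ #{i ∈ K | H.IsMissing c x i} + H.degree x := by
  classical
  have hsub : {i ∈ K | ¬ H.IsMissing c x i} ⊆ (H.neighborFinset x).image fun y => c s(x, y) := by
    intro i hi
    have := (mem_filter.1 hi).2
    simp only [IsMissing, not_forall, not_not] at this
    obtain ⟨y, hy, rfl⟩ := this
    exact mem_image.2 ⟨y, by simpa using hy, rfl⟩
  have := (card_le_card hsub).trans card_image_le
  have hadd : #{i ∈ K | H.IsMissing c x i} + #{i ∈ K | ¬ H.IsMissing c x i} = #K :=
    card_filter_add_card_filter_not _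
  rw [card_neighborFinset_eq_degree] at this
  omega

lemma exists_isMissing [Fintype V] {H : SimpleGraph V} [DecidableRel H.Adj] {K : Finset ℕ}
    (c : Sym2 V → ℕ) {x : V} (hx : H.degree x < #K) : ∃ i ∈ K, H.IsMissing c x i := by
  classical
  have h := card_le_card_missing_add_degree (H := H) (K := K) (c := c) x
  obtain ⟨i, hi⟩ : {i ∈ K | H.IsMissing c x i}.Nonempty := card_pos.1 (by omega)
  exact ⟨i, mem_filter.1 hi⟩

lemma degree_deleteIncidenceSet_le [Fintype V] (H : SimpleGraph V) (v w : V) [DecidableRel H.Adj]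
    [DecidableRel (H.deleteIncidenceSet v).Adj] :
    (H.deleteIncidenceSet v).degree w ≤ H.degree w :=
  degree_le_of_le (H.deleteIncidenceSet_le v)

lemma Adj.degree_deleteIncidenceSet_lt [Fintype V] {H : SimpleGraph V} {v w : V}
    [DecidableRel H.Adj] [DecidableRel (H.deleteIncidenceSet v).Adj] (h : H.Adj v w) :
    (H.deleteIncidenceSet v).degree w < H.degree w := by
  refine card_lt_card ⟨fun x hx => ?_, fun hsub => ?_⟩
  · rw [mem_neighborFinset, deleteIncidenceSet_adj] at hx
    simpa using hx.1
  · have := hsub (show v ∈ H.neighborFinset w by simpa using h.symm)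
    rw [mem_neighborFinset, deleteIncidenceSet_adj] at this
    exact this.2.2 rfl

lemma degree_deleteIncidenceSet_self [Fintype V] (H : SimpleGraph V) (v : V)
    [DecidableRel (H.deleteIncidenceSet v).Adj] : (H.deleteIncidenceSet v).degree v = 0 := by
  by_contra h
  obtain ⟨w, hw⟩ := (degree_pos_iff_exists_adj _ _).1 (Nat.pos_of_ne_zero h)
  exact (deleteIncidenceSet_adj.1 hw).2.1 rfl

/-- Completing a colouring by giving the edges at `v` different colours missing at their other ends. -/
lemma IsEdgeColoring.patch_star {H : SimpleGraph V} {v : V} {K : Finset ℕ} {c : Sym2 V → ℕ}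
    {f : V → ℕ} (hc : (H.deleteIncidenceSet v).IsEdgeColoring K c)
    (hf : Set.InjOn f (H.neighborSet v))
    (hfm : ∀ w, H.Adj v w → f w ∈ K ∧ (H.deleteIncidenceSet v).IsMissing c w (f w)) :
    H.IsEdgeColoring K (patch {v} 0 (fun _ w => f w) c) := by
  have hself : v ∈ ({v} : Set V) := rfl
  refine ⟨fun x y hxy => ?_, fun x y z hxy hxz h => ?_⟩
  · by_cases hx : x ∈ ({v} : Set V) <;> by_cases hy : y ∈ ({v} : Set V)
    · exact absurd (hx.trans hy.symm) hxy.ne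
    · rw [patch_of_mem_of_notMem hx hy]
      exact (hfm y (hx ▸ hxy)).1
    · rw [patch_of_notMem_of_mem hx hy]
      exact (hfm x (hy ▸ hxy.symm)).1
    · rw [patch_of_notMem_of_notMem hx hy]
      exact hc.mem (deleteIncidenceSet_adj.2 ⟨hxy, hx, hy⟩)
  · by_cases hx : x ∈ ({v} : Set V)
    · have hy : y ∉ ({v} : Set V) := fun hy => hxy.ne (hx.trans hy.symm)
      have hz : z ∉ ({v} : Set V) := fun hz => hxz.ne (hx.trans hz.symm)
      rw [patch_of_mem_of_notMem hx hy, patch_of_mem_of_notMem hx hz] at h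
      rw [Set.mem_singleton_iff] at hx
      subst hx
      exact hf hxy hxz h
    · by_cases hy : y ∈ ({v} : Set V) <;> by_cases hz : z ∈ ({v} : Set V)
      · exact hy.trans hz.symm
      · rw [patch_of_notMem_of_mem hx hy, patch_of_notMem_of_notMem hx hz] at h
        exact absurd h.symm ((hfm x (hy ▸ hxy.symm)).2 (deleteIncidenceSet_adj.2 ⟨hxz, hx, hz⟩))
      · rw [patch_of_notMem_of_mem hx hz, patch_of_notMem_of_notMem hx hy] at h
        exact absurd h ((hfm x (hz ▸ hxz.symm)).2 (deleteIncidenceSet_adj.2 ⟨hxy, hx, hy⟩))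
      · rw [patch_of_notMem_of_notMem hx hy, patch_of_notMem_of_notMem hx hz] at h
        exact hc.inj (deleteIncidenceSet_adj.2 ⟨hxy, hx, hy⟩)
          (deleteIncidenceSet_adj.2 ⟨hxz, hx, hz⟩) h

/-- A form of Vizing's theorem: a graph with degrees at most `k`, at most two of them equal to `k`,
has a proper edge-colouring with `k` colours. The edges at a vertex `v` of maximum degree are
coloured last; then at most one neighbour of `v` has degree `k`, so that all neighbours but one
have two colours to reserve. -/
theorem exists_isEdgeColoring_range [Fintype V] (H : SimpleGraph V) [DecidableRel H.Adj] (k : ℕ)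
    (hk : ∀ x, H.degree x ≤ k) (h2 : #{x | H.degree x = k} ≤ 2) :
    ∃ c, H.IsEdgeColoring (range k) c := by
  classical
  induction hm : #H.edgeFinset using Nat.strong_induction_on generalizing H with
  | _ m ih =>
  by_cases hbot : ∃ a b, H.Adj a b
  swap
  · push Not at hbot
    exact ⟨fun _ => 0, fun x y h => absurd h (hbot x y), fun x y z h => absurd h (hbot x y)⟩
  obtain ⟨a, b, hab⟩ := hbot
  have : Nonempty V := ⟨a⟩
  obtain ⟨v, hv⟩ := H.exists_maximal_degree_vertex
  have hmax : ∀ w, H.degree w ≤ H.degree v := fun w => hv ▸ H.degree_le_maxDegree w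
  have hvpos : 0 < H.degree v := hab.degree_pos_left.trans_le (hmax a)
  obtain ⟨b', hb'⟩ := (degree_pos_iff_exists_adj _ _).1 hvpos
  have hle := H.deleteIncidenceSet_le v
  obtain ⟨c, hc⟩ := ih _ (by
      rw [← hm]
      refine card_lt_card (edgeFinset_ssubset_edgeFinset.2 (lt_of_le_of_ne hle fun h => ?_))
      rw [← h, deleteIncidenceSet_adj] at hb'
      exact hb'.2.1 rfl) (H.deleteIncidenceSet v)
    (fun x => (H.degree_deleteIncidenceSet_le v x).trans (hk x))
    (by
      refine (card_le_card fun x hx => ?_).trans h2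
      rw [mem_filter] at hx ⊢
      exact ⟨hx.1, le_antisymm (hk x) (hx.2 ▸ H.degree_deleteIncidenceSet_le v x)⟩) rfl
  obtain ⟨w₀, hw₀⟩ : ∃ w₀, ∀ w, H.Adj v w → w ≠ w₀ → H.degree w < k := by
    by_contra! hcon
    obtain ⟨w₁, hw₁, -, hw₁k⟩ := hcon v
    obtain ⟨w₂, hw₂, hne, hw₂k⟩ := hcon w₁
    have hvk : k ≤ H.degree v := hw₁k.trans (hmax w₁)
    have : #{v, w₁, w₂} ≤ #{x | H.degree x = k} := by
      refine card_le_card fun x hx => mem_filter.2 ⟨mem_univ x, le_antisymm (hk x) ?_⟩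
      simp only [mem_insert, mem_singleton] at hx
      rcases hx with rfl | rfl | rfl <;> assumption
    rw [card_eq_three.2 ⟨v, w₁, w₂, hw₁.ne, hw₂.ne, hne.symm, rfl⟩] at this
    omega
  have hcard : ∀ w, k ≤ #{i ∈ range k | (H.deleteIncidenceSet v).IsMissing c w i} +
      (H.deleteIncidenceSet v).degree w := fun w => by
    simpa using card_le_card_missing_add_degree (H := H.deleteIncidenceSet v)
      (K := range k) (c := c) w
  have hres : (H.deleteIncidenceSet v).IsReserved (range k) (H.neighborFinset v) c
      (fun w => {i ∈ range k | (H.deleteIncidenceSet v).IsMissing c w i}) :=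
    ⟨hc, fun w _ => filter_subset _ _, fun w _ i hi => (mem_filter.1 hi).2⟩
  obtain ⟨c', f, hc', hf, hfm⟩ := hres.exists_injOn_missing (w₀ := w₀)
    (by rw [card_range, card_neighborFinset_eq_degree]; exact hk v)
    (fun w hw => by
      have h3 := Adj.degree_deleteIncidenceSet_lt (show H.Adj v w by simpa using hw)
      have := hcard w
      have := hk w
      omega)
    (fun w hw hne => by
      have hvw : H.Adj v w := by simpa using hw
      have h3 := hvw.degree_deleteIncidenceSet_lt
      have := hcard w
      have := hw₀ w hvw hne
      omega)
  exact ⟨_, hc'.patch_star (by simpa using hf) fun w hw => hfm w (by simpa using hw)⟩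

/-! ### Upper bounds from colourings proper off one vertex -/

/-- The edges of `G` between `S` and its complement have different colours. -/
def IsRainbowSide (G : SimpleGraph V) (c : Sym2 V → ℕ) (S : Set V) : Prop :=
  ∀ ⦃a b a' b'⦄, a ∈ S → b ∉ S → a' ∈ S → b' ∉ S → G.Adj a b → G.Adj a' b' →
    c s(a, b) = c s(a', b') → s(a, b) = s(a', b')

lemma rd_le_of_forall_isRainbowSide {G : SimpleGraph V} {k : ℕ} (c : Sym2 V → ℕ)
    (hk : ∀ x y, G.Adj x y → c s(x, y) < k)
    (hsep : ∀ u v, u ≠ v → ∃ S, G.IsRainbowSide c S ∧ ((u ∈ S ∧ v ∉ S) ∨ (v ∈ S ∧ u ∉ S))) :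
    G.rd ≤ k := by
  have hk' : ∀ e : G.edgeSet, c e < k := by
    rintro ⟨e, he⟩
    induction e with
    | _ x y => exact hk x y he
  refine Nat.sInf_le ⟨fun e => ⟨c e, hk' e⟩, fun u v huv => ?_⟩
  obtain ⟨S, hS, huvS⟩ := hsep u v huv
  refine ⟨{e | ∃ a b, a ∈ S ∧ b ∉ S ∧ e.1 = s(a, b)}, ?_, ?_⟩
  · rintro ⟨_, he⟩ ⟨a, b, ha, hb, rfl⟩ ⟨_, he'⟩ ⟨a', b', ha', hb', rfl⟩ h
    exact Subtype.ext (hS ha hb ha' hb' he he' (by simpa using h))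
  · have key : ∀ u v, u ∈ S → v ∉ S → ¬ (G.deleteEdges (Subtype.val ''
        {e : G.edgeSet | ∃ a b, a ∈ S ∧ b ∉ S ∧ e.1 = s(a, b)})).Reachable u v := by
      rintro u v hu hv ⟨p⟩
      obtain ⟨d, -, hd, hd'⟩ := p.exists_boundary_dart S hu hv
      have hadj := deleteEdges_adj.1 d.adj
      exact hadj.2 ⟨⟨_, hadj.1⟩, ⟨_, _, hd, hd', rfl⟩, rfl⟩
    rcases huvS with ⟨hu, hv⟩ | ⟨hv, hu⟩
    · exact key u v hu hv
    · exact fun h => key v u hv hu h.symm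

/-- A colouring that is proper at all vertices outside `B` cuts such a vertex off by the edges at
it, so only pairs of vertices in `B` need an argument. -/
lemma rd_le_of_proper_off {G : SimpleGraph V} {k : ℕ} (c : Sym2 V → ℕ)
    (hk : ∀ x y, G.Adj x y → c s(x, y) < k) (B : Set V)
    (hproper : ∀ x, x ∉ B → ∀ y z, G.Adj x y → G.Adj x z → c s(x, y) = c s(x, z) → y = z)
    (hB : ∀ u ∈ B, ∀ v ∈ B, u ≠ v →
      ∃ S, G.IsRainbowSide c S ∧ ((u ∈ S ∧ v ∉ S) ∨ (v ∈ S ∧ u ∉ S))) : G.rd ≤ k := by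
  have hstar : ∀ x, x ∉ B → G.IsRainbowSide c {x} := by
    rintro x hx a b a' b' rfl - rfl - hab hab' h
    rw [hproper _ hx b b' hab hab' h]
  refine rd_le_of_forall_isRainbowSide c hk fun u v huv => ?_
  by_cases hu : u ∈ B
  · by_cases hv : v ∈ B
    · exact hB u hu v hv huv
    · exact ⟨{v}, hstar v hv, Or.inr ⟨rfl, huv⟩⟩
  · exact ⟨{u}, hstar u hu, Or.inl ⟨rfl, huv.symm⟩⟩

/-- With `v` deleted, at most two vertices can have degree `k`, namely vertices not adjacent to
`v`; so what is left has a proper edge-colouring with `k` colours, and each edge at `v` can be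
given a colour missing at its other end. -/
theorem Connected.rd_le_of_degree_le [Fintype V] {G : SimpleGraph V} [DecidableRel G.Adj]
    (hG : G.Connected) {k : ℕ} {v : V} (hmax : ∀ w, G.degree w ≤ G.degree v)
    (hk : ∀ w, w ≠ v → G.degree w ≤ k) (h2 : 2 ≤ Fintype.card V) (hn : Fintype.card V ≤ k + 3) :
    G.rd ≤ k := by
  classical
  have : Nontrivial V := Fintype.one_lt_card_iff_nontrivial.1 h2
  have hk0 : 0 < k := by
    obtain ⟨w, hw⟩ := exists_ne v
    exact (hG.preconnected.degree_pos_of_nontrivial w).trans_le (hk w hw)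
  have hHk : ∀ w, (G.deleteIncidenceSet v).degree w ≤ k := fun w => by
    rcases eq_or_ne w v with rfl | hw
    · rw [degree_deleteIncidenceSet_self]
      exact hk0.le
    · exact (G.degree_deleteIncidenceSet_le v w).trans (hk w hw)
  have hH2 : #{w | (G.deleteIncidenceSet v).degree w = k} ≤ 2 := by
    have hprop : ∀ w, (G.deleteIncidenceSet v).degree w = k →
        w ∉ insert v (G.neighborFinset v) ∧ k ≤ G.degree v := by
      intro w hw
      have hwv : w ≠ v := by
        rintro rfl
        rw [degree_deleteIncidenceSet_self] at hw
        omega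
      refine ⟨fun hmem => ?_, ?_⟩
      · rw [mem_insert, mem_neighborFinset] at hmem
        have := (hmem.resolve_left hwv).degree_deleteIncidenceSet_lt
        have := hk w hwv
        omega
      · exact hw ▸ (G.degree_deleteIncidenceSet_le v w).trans (hmax w)
    by_cases hvk : k ≤ G.degree v
    · calc #{w | (G.deleteIncidenceSet v).degree w = k}
          ≤ #(insert v (G.neighborFinset v))ᶜ := card_le_card fun w hw =>
            mem_compl.2 (hprop w (mem_filter.1 hw).2).1
        _ ≤ 2 := by
            rw [card_compl, card_insert_of_notMem (by simp), card_neighborFinset_eq_degree]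
            omega
    · rw [filter_eq_empty_iff.2 fun w _ hw => hvk (hprop w hw).2]
      simp
  obtain ⟨c, hc⟩ := (G.deleteIncidenceSet v).exists_isEdgeColoring_range k hHk hH2
  have hf : ∀ w, ∃ i, G.Adj v w → i ∈ range k ∧ (G.deleteIncidenceSet v).IsMissing c w i := by
    intro w
    by_cases hw : G.Adj v w
    · obtain ⟨i, hi⟩ := exists_isMissing (H := G.deleteIncidenceSet v) (K := range k) c (x := w) (by
        have := hw.degree_deleteIncidenceSet_lt
        have := hk w hw.ne'
        rw [card_range]
        omega)
      exact ⟨i, fun _ => hi⟩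
    · exact ⟨0, fun h => absurd h hw⟩
  choose f hf using hf
  have hdel : ∀ {x y}, x ∉ ({v} : Set V) → y ∉ ({v} : Set V) → G.Adj x y →
      (G.deleteIncidenceSet v).Adj x y := fun hx hy h => deleteIncidenceSet_adj.2 ⟨h, hx, hy⟩
  refine rd_le_of_proper_off (patch {v} 0 (fun _ w => f w) c) (fun x y hxy => ?_) {v}
    (fun x hx y z hxy hxz h => ?_) ?_
  · rw [← mem_range]
    by_cases hx : x ∈ ({v} : Set V) <;> by_cases hy : y ∈ ({v} : Set V)
    · exact absurd (hx.trans hy.symm) hxy.ne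
    · rw [patch_of_mem_of_notMem hx hy]
      exact (hf y (hx ▸ hxy)).1
    · rw [patch_of_notMem_of_mem hx hy]
      exact (hf x (hy ▸ hxy.symm)).1
    · rw [patch_of_notMem_of_notMem hx hy]
      exact hc.mem (hdel hx hy hxy)
  · by_cases hy : y ∈ ({v} : Set V) <;> by_cases hz : z ∈ ({v} : Set V)
    · exact hy.trans hz.symm
    · rw [patch_of_notMem_of_mem hx hy, patch_of_notMem_of_notMem hx hz] at h
      exact absurd h.symm ((hf x (hy ▸ hxy.symm)).2 (hdel hx hz hxz))
    · rw [patch_of_notMem_of_mem hx hz, patch_of_notMem_of_notMem hx hy] at h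
      exact absurd h ((hf x (hz ▸ hxz.symm)).2 (hdel hx hy hxy))
    · rw [patch_of_notMem_of_notMem hx hy, patch_of_notMem_of_notMem hx hz] at h
      exact hc.inj (hdel hx hy hxy) (hdel hx hz hxz) h
  · rintro u rfl w rfl h
    exact absurd rfl h

/-! ### Upper bound for two vertices with a small cut -/

/-- The graph obtained from `G` by deleting the edges inside `S` at `u`, the edges outside `S` at
`v` and the edge `uv`, and then replacing each edge `vq` by `uq`: the edges between `S ∋ u` and its
complement, except `uv`, become edges at `u`, provided that all of them contain `u` or `v`. -/
def merge (G : SimpleGraph V) (u v : V) (S : Set V) : SimpleGraph V where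
  Adj p q := p ≠ v ∧ q ≠ v ∧ ((p ≠ u ∧ q ≠ u ∧ G.Adj p q) ∨
    (p = u ∧ q ≠ u ∧ (q ∈ S ∧ G.Adj v q ∨ q ∉ S ∧ G.Adj u q)) ∨
    (q = u ∧ p ≠ u ∧ (p ∈ S ∧ G.Adj v p ∨ p ∉ S ∧ G.Adj u p)))
  symm := ⟨fun p q h => ⟨h.2.1, h.1, by
    rcases h.2.2 with h | h | h
    · exact Or.inl ⟨h.2.1, h.1, h.2.2.symm⟩
    · exact Or.inr (Or.inr h)
    · exact Or.inr (Or.inl h)⟩⟩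
  loopless := ⟨fun p h => by
    rcases h.2.2 with h | h | h
    · exact G.loopless.irrefl p h.2.2
    · exact h.2.1 h.1
    · exact h.2.1 h.1⟩

/-- Two adjacent vertices `u` and `v`, each with one non-neighbour, separated by `S`. The merged
graph has degrees below `k`; a proper edge-colouring of it makes the edges between `S` and its
complement rainbow and leaves a colour for `uv`, and the deleted edges can be given colours missing
at their ends other than `u` and `v`. -/
theorem rd_le_of_separating_set [Fintype V] {G : SimpleGraph V} [DecidableRel G.Adj] {k : ℕ}
    {u v x y : V} {S : Set V} (hu : u ∈ S) (hv : v ∉ S) (hx : x ∈ S) (hy : y ∉ S) (hxu : x ≠ u)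
    (hyv : y ≠ v) (hnvx : ¬ G.Adj v x) (hnuy : ¬ G.Adj u y)
    (huadj : ∀ q, q ≠ u → q ≠ y → G.Adj u q) (hvadj : ∀ q, q ≠ v → q ≠ x → G.Adj v q)
    (hS : ∀ a b, a ∈ S → b ∉ S → G.Adj a b → a = u ∨ b = v)
    (hk : ∀ q, q ≠ u → q ≠ v → G.degree q ≤ k) (hn : Fintype.card V ≤ k + 3) : G.rd ≤ k := by
  classical
  have huv : u ≠ v := fun h => hv (h ▸ hu)
  have hxv : x ≠ v := fun h => hv (h ▸ hx)
  have hyu : y ≠ u := fun h => hy (h ▸ hu)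
  have hxy : x ≠ y := fun h => hy (h ▸ hx)
  set H := G.merge u v S with hH
  have h4 : #{u, v, x, y} = 4 := by
    rw [card_insert_of_notMem, card_eq_three.2 ⟨v, x, y, hxv.symm, hyv.symm, hxy, rfl⟩]
    simp [huv, hxu.symm, hyu.symm]
  have hn4 : 4 ≤ Fintype.card V := h4 ▸ card_le_univ _
  -- A vertex `q` loses its edge to `u` or to `v`, namely the one on its side of the cut; `u` keeps no
  -- edge to `v`, `x` or `y`.
  have hdeg : ∀ q, H.degree q < k := by
    intro q
    by_cases hqv : q = v
    · have : H.degree q = 0 := by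
        by_contra h0
        obtain ⟨w, hw⟩ := (degree_pos_iff_exists_adj _ _).1 (Nat.pos_of_ne_zero h0)
        exact hw.1 hqv
      omega
    by_cases hqu : q = u
    · subst hqu
      have hsub : H.neighborFinset q ⊆ ({q, v, x, y} : Finset V)ᶜ := by
        intro z hz
        rw [mem_neighborFinset] at hz
        obtain ⟨-, hzv, h | h | h⟩ := hz
        · exact absurd rfl h.1
        · simp only [mem_compl, mem_insert, mem_singleton, not_or]
          refine ⟨h.2.1, hzv, ?_, ?_⟩
          · rintro rfl
            exact h.2.2.elim (fun h => hnvx h.2) (fun h => h.1 hx)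
          · rintro rfl
            exact h.2.2.elim (fun h => hy h.1) (fun h => hnuy h.2)
        · exact absurd rfl h.2.1
      have := card_le_card hsub
      rw [card_compl, h4, card_neighborFinset_eq_degree] at this
      omega
    · by_cases hqS : q ∈ S
      · have huq : u ∈ G.neighborFinset q := by
          rw [mem_neighborFinset]
          exact (huadj q hqu fun h => hy (h ▸ hqS)).symm
        have hle : H.degree q ≤ #((G.neighborFinset q).erase u) := by
          refine card_le_card_of_injOn (fun z => if z = u then v else z) ?_ ?_
          · intro z hz
            rw [coe_neighborFinset, mem_neighborSet] at hz
            rw [mem_coe, mem_erase, mem_neighborFinset]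
            obtain ⟨-, hzv, h | h | h⟩ := hz
            · simpa [h.2.1] using h.2.2
            · exact absurd h.1 hqu
            · simp only [if_pos h.1]
              exact ⟨huv.symm, (h.2.2.resolve_right fun h => h.1 hqS).2.symm⟩
          · intro z hz w hw hzw
            rw [coe_neighborFinset, mem_neighborSet] at hz hw
            dsimp only at hzw
            split_ifs at hzw with h1 h2 h2
            · rw [h1, h2]
            · exact absurd hzw.symm hw.2.1
            · exact absurd hzw hz.2.1
            · exact hzw
        have hpos := card_pos.2 ⟨u, huq⟩
        rw [card_erase_of_mem huq] at hle
        rw [card_neighborFinset_eq_degree] at hle hpos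
        have := hk q hqu hqv
        omega
      · have hvq : v ∈ G.neighborFinset q := by
          rw [mem_neighborFinset]
          exact (hvadj q hqv fun h => hqS (h ▸ hx)).symm
        have hle : H.degree q ≤ #((G.neighborFinset q).erase v) := by
          refine card_le_card fun z hz => ?_
          rw [mem_neighborFinset] at hz
          rw [mem_erase, mem_neighborFinset]
          obtain ⟨-, hzv, h | h | h⟩ := hz
          · exact ⟨hzv, h.2.2⟩
          · exact absurd h.1 hqu
          · exact ⟨hzv, h.1 ▸ (h.2.2.resolve_left fun h => hqS h.1).2.symm⟩
        have hpos := card_pos.2 ⟨v, hvq⟩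
        rw [card_erase_of_mem hvq] at hle
        rw [card_neighborFinset_eq_degree] at hle hpos
        have := hk q hqu hqv
        omega
  obtain ⟨c, hc⟩ := H.exists_isEdgeColoring_range k (fun q => (hdeg q).le) (by
    rw [filter_eq_empty_iff.2 fun q _ => (hdeg q).ne]
    simp)
  have hf : ∀ q, ∃ i ∈ range k, H.IsMissing c q i := fun q =>
    exists_isMissing c (by rw [card_range]; exact hdeg q)
  choose f hfk hf using hf
  let T : V → V → ℕ := fun p q => if p ∈ S ↔ q ∈ S then f q else c s(u, q)
  -- An edge from `u` or `v` to a third vertex on the other side belongs to the merged graph.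
  have hcross : ∀ p ∈ ({u, v} : Set V), ∀ q ∉ ({u, v} : Set V), G.Adj p q →
      ¬ (p ∈ S ↔ q ∈ S) → H.Adj u q := by
    intro p hp q hq hpq hpqS
    rw [Set.mem_insert_iff, Set.mem_singleton_iff, not_or] at hq
    refine ⟨huv, hq.2, Or.inr (Or.inl ⟨rfl, hq.1, ?_⟩)⟩
    rcases hp with rfl | hp
    · exact Or.inr ⟨fun h => hpqS ⟨fun _ => h, fun _ => hu⟩, hpq⟩
    · rw [Set.mem_singleton_iff] at hp
      subst hp
      refine Or.inl ⟨?_, hpq⟩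
      by_contra h
      exact hpqS ⟨fun h' => absurd h' hv, fun h' => absurd h' h⟩
  have hinner : ∀ p ∉ ({u, v} : Set V), ∀ q ∉ ({u, v} : Set V), G.Adj p q → H.Adj p q := by
    intro p hp q hq hpq
    rw [Set.mem_insert_iff, Set.mem_singleton_iff, not_or] at hp hq
    exact ⟨hp.2, hq.2, Or.inl ⟨hp.1, hq.1, hpq⟩⟩
  have hTk : ∀ p ∈ ({u, v} : Set V), ∀ q ∉ ({u, v} : Set V), G.Adj p q → T p q ∈ range k := by
    intro p hp q hq hpq
    simp only [T]
    split_ifs with h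
    · exact hfk q
    · exact hc.mem (hcross p hp q hq hpq h)
  -- The colours at `q` of an edge to `u` or `v` and of an edge to a third vertex.
  have hTne : ∀ p ∈ ({u, v} : Set V), ∀ q ∉ ({u, v} : Set V), ∀ z ∉ ({u, v} : Set V),
      G.Adj p q → G.Adj q z → T p q ≠ c s(q, z) := by
    intro p hp q hq z hz hpq hqz h
    simp only [T] at h
    split_ifs at h with h'
    · exact hf q (hinner q hq z hz hqz) h.symm
    · rw [Sym2.eq_swap] at h
      have := hc.inj (hcross p hp q hq hpq h').symm (hinner q hq z hz hqz) h
      exact hz (Or.inl this.symm)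
  have hTuv : ∀ q ∉ ({u, v} : Set V), G.Adj u q → G.Adj v q → T u q ≠ T v q := by
    intro q hq huq hvq h
    have hmem := hcross v (Or.inr rfl) q hq hvq
    have hmem' := hcross u (Or.inl rfl) q hq huq
    by_cases hqS : q ∈ S
    · simp only [T, hu, hv, hqS, iff_true, if_true, iff_self, if_false] at h hmem
      rw [Sym2.eq_swap] at h
      exact hf q (hmem not_false).symm h.symm
    · simp only [T, hu, hv, hqS, if_true, iff_self, if_false, iff_false, not_true]
        at h hmem'
      rw [Sym2.eq_swap] at h
      exact hf q (hmem' not_false).symm h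
  have huB : u ∈ ({u, v} : Set V) := Or.inl rfl
  have hvB : v ∈ ({u, v} : Set V) := Or.inr rfl
  refine rd_le_of_proper_off (patch {u, v} (f u) T c) (fun p q hpq => ?_) {u, v}
    (fun q hq a b hqa hqb h => ?_) ?_
  · rw [← mem_range]
    by_cases hp : p ∈ ({u, v} : Set V) <;> by_cases hq : q ∈ ({u, v} : Set V)
    · rw [patch_of_mem_of_mem hp hq]
      exact hfk u
    · rw [patch_of_mem_of_notMem hp hq]
      exact hTk p hp q hq hpq
    · rw [patch_of_notMem_of_mem hp hq]
      exact hTk q hq p hp hpq.symm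
    · rw [patch_of_notMem_of_notMem hp hq]
      exact hc.mem (hinner p hp q hq hpq)
  · by_cases ha : a ∈ ({u, v} : Set V) <;> by_cases hb : b ∈ ({u, v} : Set V)
    · rw [patch_of_notMem_of_mem hq ha, patch_of_notMem_of_mem hq hb] at h
      rcases ha with rfl | rfl <;> rcases hb with rfl | rfl
      · rfl
      · exact absurd h (hTuv q hq hqa.symm hqb.symm)
      · exact absurd h.symm (hTuv q hq hqb.symm hqa.symm)
      · rfl
    · rw [patch_of_notMem_of_mem hq ha, patch_of_notMem_of_notMem hq hb] at h
      exact absurd h (hTne a ha q hq b hb hqa.symm hqb)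
    · rw [patch_of_notMem_of_mem hq hb, patch_of_notMem_of_notMem hq ha] at h
      exact absurd h.symm (hTne b hb q hq a ha hqb.symm hqa)
    · rw [patch_of_notMem_of_notMem hq ha, patch_of_notMem_of_notMem hq hb] at h
      exact hc.inj (hinner q hq a ha hqa) (hinner q hq b hb hqb) h
  · -- The edges other than `uv` between the sides have the colours of edges of the merged graph
    -- at `u`, from whose other ends they can be recovered.
    have hside : ∀ a b, a ∈ S → b ∉ S → G.Adj a b →
        (a = u ∧ b = v ∧ patch {u, v} (f u) T c s(a, b) = f u) ∨
        ∃ q, H.Adj u q ∧ patch {u, v} (f u) T c s(a, b) = c s(u, q) ∧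
          s(a, b) = if q ∈ S then s(q, v) else s(u, q) := by
      intro a b ha hb hab
      by_cases hau : a = u
      · subst hau
        by_cases hbv : b = v
        · subst hbv
          exact Or.inl ⟨rfl, rfl, patch_of_mem_of_mem huB hvB⟩
        · have hbB : b ∉ ({a, v} : Set V) := by
            rintro (h | h)
            · exact hab.ne h.symm
            · exact hbv h
          have hnS : ¬ (a ∈ S ↔ b ∈ S) := fun h => hb (h.1 ha)
          refine Or.inr ⟨b, hcross a huB b hbB hab hnS, ?_, by rw [if_neg hb]⟩
          rw [patch_of_mem_of_notMem huB hbB]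
          exact if_neg hnS
      · have hbv := (hS a b ha hb hab).resolve_left hau
        subst hbv
        have haB : a ∉ ({u, b} : Set V) := by
          rintro (h | h)
          · exact hau h
          · exact hab.ne h
        have hnS : ¬ (b ∈ S ↔ a ∈ S) := fun h => hb (h.2 ha)
        refine Or.inr ⟨a, hcross b hvB a haB hab.symm hnS, ?_, by rw [if_pos ha]⟩
        rw [patch_of_notMem_of_mem haB hvB]
        exact if_neg hnS
    have hrain : G.IsRainbowSide (patch {u, v} (f u) T c) S := by
      intro a b a' b' ha hb ha' hb' hab hab' h
      rcases hside a b ha hb hab with ⟨h1, h2, h3⟩ | ⟨q, h1, h2, h3⟩ <;>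
        rcases hside a' b' ha' hb' hab' with ⟨h1', h2', h3'⟩ | ⟨q', h1', h2', h3'⟩
      · rw [h1, h2, h1', h2']
      · exact absurd (h2'.symm.trans (h.symm.trans h3)) (hf u h1')
      · exact absurd (h2.symm.trans (h.trans h3')) (hf u h1)
      · have := hc.inj h1 h1' (h2.symm.trans (h.trans h2'))
        rw [h3, h3', this]
    rintro a (rfl | rfl) b (rfl | rfl) hab
    · exact absurd rfl hab
    · exact ⟨S, hrain, Or.inl ⟨hu, hv⟩⟩
    · exact ⟨S, hrain, Or.inr ⟨hu, hv⟩⟩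
    · exact absurd rfl hab

/-! ### Lower bounds -/

/-- Some set `S` contains `u` but not `v` and has at most `rd G` edges to its complement, and these
include `wv` or `uw` for each vertex `w` of `N(u) ∩ N[v]`. -/
theorem exists_cut_of_card_inter_le_rd [Fintype V] [DecidableEq V] (G : SimpleGraph V)
    [DecidableRel G.Adj] {u v : V} (huv : u ≠ v) :
    ∃ S : Set V, u ∈ S ∧ v ∉ S ∧ #(G.neighborFinset u ∩ insert v (G.neighborFinset v)) ≤ G.rd ∧
      ∀ a b, a ∈ S → b ∉ S → G.Adj a b →
        (a = u → b ∉ G.neighborFinset u ∩ insert v (G.neighborFinset v)) →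
        (b = v → a ∉ G.neighborFinset u ∩ insert v (G.neighborFinset v)) →
        #(G.neighborFinset u ∩ insert v (G.neighborFinset v)) + 1 ≤ G.rd := by
  classical
  obtain ⟨c, hc⟩ := G.exists_isRainbowDisconnected
  obtain ⟨R, hR, huvR⟩ := hc u v huv
  set T := G.neighborFinset u ∩ insert v (G.neighborFinset v)
  let S : Set V := {w | (G.deleteEdges (Subtype.val '' R)).Reachable u w}
  have huS : u ∈ S := Reachable.refl u
  have hcutR : ∀ a b, a ∈ S → b ∉ S → G.Adj a b → s(a, b) ∈ Subtype.val '' R := by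
    intro a b ha hb hab
    by_contra h
    exact hb (Reachable.trans (show (G.deleteEdges _).Reachable u a from ha)
      (Adj.reachable (deleteEdges_adj.2 ⟨hab, h⟩)))
  have hcard : ∀ E : Finset (Sym2 V), (∀ e ∈ E, e ∈ Subtype.val '' R) → #E ≤ G.rd := by
    intro E hE
    have hsub : E ⊆ R.toFinset.image Subtype.val := fun e he => by
      simpa using hE e he
    calc #E ≤ #R.toFinset := (card_le_card hsub).trans card_image_le
      _ ≤ #(univ : Finset (Fin G.rd)) := card_le_card_of_injOn c (by simp) (by simpa using hR)
      _ = G.rd := by simp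
  let g : V → Sym2 V := fun w => if w ∈ S then s(w, v) else s(u, w)
  have hT : ∀ w ∈ T, G.Adj u w ∧ (w = v ∨ G.Adj v w) := by
    intro w hw
    simpa [T] using hw
  have hgR : ∀ w ∈ T, g w ∈ Subtype.val '' R := by
    intro w hw
    obtain ⟨h1, h2⟩ := hT w hw
    simp only [g]
    split_ifs with hwS
    · exact hcutR w v hwS huvR ((h2.resolve_left fun h => huvR (h ▸ hwS)).symm)
    · exact hcutR u w huS hwS h1
  have hginj : Set.InjOn g T := by
    intro w hw w' hw' h
    have h1 := (hT w hw).1.ne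
    have h1' := (hT w' hw').1.ne
    simp only [g] at h
    split_ifs at h with h2 h3 h3
    · rcases Sym2.eq_iff.1 h with h | h
      · exact h.1
      · exact h.1.trans h.2
    · rcases Sym2.eq_iff.1 h with h | h
      · exact absurd h.1.symm h1
      · exact absurd (h.1 ▸ h2) h3
    · rcases Sym2.eq_iff.1 h with h | h
      · exact absurd h.1 h1'
      · exact absurd h.1 huv
    · rcases Sym2.eq_iff.1 h with h | h
      · exact h.2
      · exact absurd h.1 h1'
  refine ⟨S, huS, huvR, ?_, fun a b ha hb hab h1 h2 => ?_⟩
  · rw [← card_image_of_injOn hginj]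
    refine hcard _ fun e he => ?_
    obtain ⟨w, hw, rfl⟩ := mem_image.1 he
    exact hgR w hw
  · have hnot : s(a, b) ∉ T.image g := by
      intro he
      obtain ⟨w, hw, he⟩ := mem_image.1 he
      simp only [g] at he
      split_ifs at he with hwS
      · rcases Sym2.eq_iff.1 he with h | h
        · exact h2 h.2.symm (h.1 ▸ hw)
        · exact hb (h.1 ▸ hwS)
      · rcases Sym2.eq_iff.1 he with h | h
        · exact h1 h.1.symm (h.2 ▸ hw)
        · exact hb (h.1 ▸ huS)
    rw [← card_image_of_injOn hginj, ← card_insert_of_notMem hnot]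
    refine hcard _ fun e he => ?_
    rcases mem_insert.1 he with rfl | he
    · exact hcutR a b ha hb hab
    · obtain ⟨w, hw, rfl⟩ := mem_image.1 he
      exact hgR w hw

/-- If `N(u) ⊆ N[v]`, then the cut has an edge for each neighbour of `u`. -/
lemma degree_le_rd_of_forall_adj [Fintype V] {G : SimpleGraph V} [DecidableRel G.Adj] {u v : V}
    (huv : u ≠ v) (h : ∀ q, G.Adj u q → q ≠ v → G.Adj v q) : G.degree u ≤ G.rd := by
  classical
  obtain ⟨-, -, -, hle, -⟩ := G.exists_cut_of_card_inter_le_rd huv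
  refine (card_le_card fun q hq => ?_).trans hle
  rw [mem_neighborFinset] at hq
  simp only [mem_inter, mem_insert, mem_neighborFinset]
  exact ⟨hq, or_iff_not_imp_left.2 (h q hq)⟩

/-- The path from `u` to `v` through `x` and `y` contributes an edge to every cut, in addition to
those at the common neighbours of `u` and `v`. -/
lemma degree_le_rd_of_reachable [Fintype V] {G : SimpleGraph V} [DecidableRel G.Adj] {u v : V}
    (huv : u ≠ v) {x y : ↥({u, v}ᶜ : Set V)} (hux : G.Adj u x) (hvx : ¬ G.Adj v x)
    (hvy : G.Adj v y) (huy : ¬ G.Adj u y) (h : ∀ q, q ≠ v → q ≠ x → G.Adj v q)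
    (hxy : (G.induce ({u, v}ᶜ : Set V)).Reachable x y) : G.degree u ≤ G.rd := by
  classical
  obtain ⟨S, hu, hv, -, hS⟩ := G.exists_cut_of_card_inter_le_rd huv
  have hne : ∀ z : ↥({u, v}ᶜ : Set V), (z : V) ≠ u ∧ (z : V) ≠ v := fun z =>
    ⟨fun h => z.2 (Or.inl h), fun h => z.2 (Or.inr h)⟩
  have hmem : ∀ q, q ∈ G.neighborFinset u ∩ insert v (G.neighborFinset v) ↔
      G.Adj u q ∧ (q = v ∨ G.Adj v q) := by
    intro q
    simp
  have hcard : G.degree u ≤ #(G.neighborFinset u ∩ insert v (G.neighborFinset v)) + 1 := by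
    rw [← card_neighborFinset_eq_degree, ← card_erase_add_one (a := (x : V)) (by simpa using hux)]
    refine Nat.add_le_add_right (card_le_card fun q hq => ?_) 1
    rw [mem_erase, mem_neighborFinset] at hq
    exact (hmem q).2 ⟨hq.2, or_iff_not_imp_left.2 fun hqv => h q hqv hq.1⟩
  refine hcard.trans ?_
  by_cases hxS : (x : V) ∈ S
  · by_cases hyS : (y : V) ∈ S
    · refine hS y v hyS hv hvy.symm (fun hyu => absurd hyu (hne y).1) fun _ hy => ?_
      exact huy ((hmem _).1 hy).1
    · obtain ⟨p⟩ := hxy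
      obtain ⟨d, -, hd, hd'⟩ := p.exists_boundary_dart (Subtype.val ⁻¹' S) hxS hyS
      exact hS d.fst d.snd hd hd' d.adj (fun h => absurd h (hne _).1) (fun h => absurd h (hne _).2)
  · refine hS u x hu hxS hux (fun _ hx => ?_) fun hxv => absurd hxv (hne x).2
    exact ((hmem _).1 hx).2.elim (hne x).2 hvx

/-! ### Vertices of degree `n - 1` and `n - 2` -/

lemma adj_of_degree_eq_card_sub_one [Fintype V] {G : SimpleGraph V} [DecidableRel G.Adj] {v : V}
    (hv : G.degree v = Fintype.card V - 1) {q : V} (hq : q ≠ v) : G.Adj v q := by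
  classical
  by_contra h
  have hsub : G.neighborFinset v ⊆ ({v, q} : Finset V)ᶜ := by
    intro z hz
    rw [mem_neighborFinset] at hz
    simp only [mem_compl, mem_insert, mem_singleton, not_or]
    exact ⟨hz.ne', fun hzq => h (hzq ▸ hz)⟩
  have h1 := card_le_card hsub
  have h2 : #{v, q} = 2 := card_pair hq.symm
  have h3 : #{v, q} ≤ Fintype.card V := card_le_univ _
  rw [card_compl, h2, card_neighborFinset_eq_degree] at h1
  omega

lemma adj_of_degree_eq_card_sub_two [Fintype V] {G : SimpleGraph V} [DecidableRel G.Adj] {v z : V}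
    (hv : G.degree v = Fintype.card V - 2) (hzv : z ≠ v) (hz : ¬ G.Adj v z) {q : V} (hq : q ≠ v)
    (hqz : q ≠ z) : G.Adj v q := by
  classical
  by_contra h
  have hsub : G.neighborFinset v ⊆ ({v, z, q} : Finset V)ᶜ := by
    intro w hw
    rw [mem_neighborFinset] at hw
    simp only [mem_compl, mem_insert, mem_singleton, not_or]
    exact ⟨hw.ne', fun h' => hz (h' ▸ hw), fun h' => h (h' ▸ hw)⟩
  have h1 := card_le_card hsub
  have h2 : #{v, z, q} = 3 := card_eq_three.2 ⟨v, z, q, hzv.symm, hq.symm, hqz.symm, rfl⟩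
  have h3 : #{v, z, q} ≤ Fintype.card V := card_le_univ _
  rw [card_compl, h2, card_neighborFinset_eq_degree] at h1
  omega

lemma exists_not_adj_of_degree_lt [Fintype V] {G : SimpleGraph V} [DecidableRel G.Adj] {v : V}
    (hv : G.degree v < Fintype.card V - 1) : ∃ z, z ≠ v ∧ ¬ G.Adj v z := by
  classical
  by_contra! h
  have hsub : univ.erase v ⊆ G.neighborFinset v := fun z hz => by
    simpa using h z (mem_erase.1 hz).1
  have := card_le_card hsub
  rw [card_erase_of_mem (mem_univ v), card_univ, card_neighborFinset_eq_degree] at this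
  omega

/-- Let `x` be the non-neighbour of `v` and `y` that of `u`; they lie in different components of
`G - {u, v}`. A third vertex of degree `n - 2` would be adjacent to `u` and `v`, by `hadj`, and to
`x` and `y`, by `ha`, and so would join `x` to `y`. Hence all other degrees are at most `n - 3`, and
the component of `x` in `G - {u, v}` together with `u` is a separating set as required by
`rd_le_of_separating_set`. -/
theorem rd_add_three_le_card [Fintype V] {G : SimpleGraph V} [DecidableRel G.Adj] {n : ℕ}
    (hn : Fintype.card V = n) (hmax : ∀ w, G.degree w ≤ n - 2)
    (hadj : ∀ u v : V, u ≠ v → G.degree u = n - 2 → G.degree v = n - 2 → G.Adj u v)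
    (ha : ∀ u v : V, u ≠ v → G.degree u = n - 2 → G.degree v = n - 2 →
      ∀ z : V, G.Adj u z ∨ G.Adj v z)
    (hb : ∀ u v : V, u ≠ v → G.degree u = n - 2 → G.degree v = n - 2 →
      ∀ x y : ↥({u, v}ᶜ : Set V), G.Adj u x → ¬ G.Adj v x → G.Adj v y → ¬ G.Adj u y →
        ¬ (G.induce ({u, v}ᶜ : Set V)).Reachable x y)
    {u v : V} (huv : u ≠ v) (hu : G.degree u = n - 2) (hv : G.degree v = n - 2) :
    G.rd + 3 ≤ n := by
  classical
  subst hn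
  have huvadj := hadj u v huv hu hv
  have hpos := huvadj.degree_pos_left
  obtain ⟨y, hyu, hy⟩ := exists_not_adj_of_degree_lt (G := G) (v := u) (by omega)
  obtain ⟨x, hxv, hx⟩ := exists_not_adj_of_degree_lt (G := G) (v := v) (by omega)
  have hyv : y ≠ v := fun h => hy (h ▸ huvadj)
  have hxu : x ≠ u := fun h => hx (h ▸ huvadj.symm)
  have hxadj : G.Adj u x := (ha u v huv hu hv x).resolve_right hx
  have hyadj : G.Adj v y := (ha u v huv hu hv y).resolve_left hy
  have hxB : x ∈ ({u, v}ᶜ : Set V) := by simp [hxu, hxv]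
  have hyB : y ∈ ({u, v}ᶜ : Set V) := by simp [hyu, hyv]
  have hnr := hb u v huv hu hv ⟨x, hxB⟩ ⟨y, hyB⟩ hxadj hx hyadj hy
  have hthird : ∀ q, q ≠ u → q ≠ v → G.degree q ≤ Fintype.card V - 3 := by
    intro q hqu hqv
    by_contra hlt
    have hq : G.degree q = Fintype.card V - 2 := by
      have := hmax q
      omega
    have hqx := (ha v q hqv.symm hv hq x).resolve_left hx
    have hqy := (ha u q hqu.symm hu hq y).resolve_left hy
    have hqB : q ∈ ({u, v}ᶜ : Set V) := by simp [hqu, hqv]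
    have h1 : (G.induce ({u, v}ᶜ : Set V)).Adj ⟨x, hxB⟩ ⟨q, hqB⟩ := hqx.symm
    have h2 : (G.induce ({u, v}ᶜ : Set V)).Adj ⟨q, hqB⟩ ⟨y, hyB⟩ := hqy
    exact hnr (h1.reachable.trans h2.reachable)
  have hcard : 3 ≤ Fintype.card V := by
    have : #{u, v, x} = 3 := card_eq_three.2 ⟨u, v, x, huv, hxu.symm, hxv.symm, rfl⟩
    exact this ▸ card_le_univ _
  let S : Set V := {q | q = u ∨ ∃ h : q ∈ ({u, v}ᶜ : Set V),
    (G.induce ({u, v}ᶜ : Set V)).Reachable ⟨x, hxB⟩ ⟨q, h⟩}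
  have hrd := rd_le_of_separating_set (G := G) (k := Fintype.card V - 3) (S := S) (u := u) (v := v)
    (x := x) (y := y) (Or.inl rfl)
    (by
      rintro (h | ⟨h, -⟩)
      · exact huv h.symm
      · exact h (Or.inr rfl))
    (Or.inr ⟨hxB, Reachable.refl _⟩)
    (by
      rintro (h | ⟨_, h⟩)
      · exact hyu h
      · exact hnr h)
    hxu hyv hx hy
    (fun q h1 h2 => adj_of_degree_eq_card_sub_two hu hyu hy h1 h2)
    (fun q h1 h2 => adj_of_degree_eq_card_sub_two hv hxv hx h1 h2)
    (by
      rintro a b (rfl | ⟨haB, har⟩) hbS hab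
      · exact Or.inl rfl
      · by_contra! h
        have hbu : b ≠ u := fun h' => hbS (Or.inl h')
        have hbB : b ∈ ({u, v}ᶜ : Set V) := by simp [hbu, h.2]
        have hab' : (G.induce ({u, v}ᶜ : Set V)).Adj ⟨a, haB⟩ ⟨b, hbB⟩ := hab
        exact hbS (Or.inr ⟨hbB, har.trans hab'.reachable⟩))
    hthird (by omega)
  omega

/-- At most one vertex of full degree suffices for the upper bound `n - 2`. -/
theorem Connected.rd_le_card_sub_two [Fintype V] {G : SimpleGraph V} [DecidableRel G.Adj]
    (hG : G.Connected) {n : ℕ} (hn : Fintype.card V = n) (hn2 : 2 ≤ n)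
    (h : ∀ u v, G.degree u = n - 1 → G.degree v = n - 1 → u = v) : G.rd ≤ n - 2 := by
  subst hn
  have := hG.nonempty
  obtain ⟨v, hv⟩ := G.exists_maximal_degree_vertex
  have hmax : ∀ w, G.degree w ≤ G.degree v := fun w => hv ▸ G.degree_le_maxDegree w
  refine hG.rd_le_of_degree_le hmax (fun w hw => ?_) hn2 (by omega)
  by_contra hlt
  have h1 := G.degree_lt_card_verts w
  have h2 := G.degree_lt_card_verts v
  have h3 := hmax w
  exact hw (h w v (by omega) (by omega))

end SimpleGraph

end

theorem mainTheorem6 {V : Type*} [Fintype V] (G : SimpleGraph V) [DecidableRel G.Adj]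
    (hG : G.Connected) (n : ℕ) (hn : Fintype.card V = n) (hn2 : 2 ≤ n) :
    G.rd = n - 2 ↔
      ((∃! a : V, G.degree a = n - 1) ∧ (∃ b : V, G.degree b = n - 2)) ∨
      (G.maxDegree = n - 2 ∧
        ∃ u v : V, u ≠ v ∧ G.degree u = n - 2 ∧ G.degree v = n - 2 ∧ ¬ G.Adj u v) ∨
      (G.maxDegree = n - 2 ∧
        (∀ u v : V, u ≠ v → G.degree u = n - 2 → G.degree v = n - 2 → G.Adj u v) ∧
        ((∃ u v : V, u ≠ v ∧ G.degree u = n - 2 ∧ G.degree v = n - 2 ∧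
            ∃ z : V, z ∉ G.neighborSet u ∪ G.neighborSet v) ∨
          (∃ u v : V, u ≠ v ∧ G.degree u = n - 2 ∧ G.degree v = n - 2 ∧
            ∃ x y : ↥({u, v}ᶜ : Set V), x ≠ y ∧
              (x : V) ∈ G.neighborSet u \ G.closedNeighborSet v ∧
              (y : V) ∈ G.neighborSet v \ G.closedNeighborSet u ∧
              (G.induce ({u, v}ᶜ : Set V)).Reachable x y))) := by
  have hne := hG.nonempty
  constructor
  · intro hrd
    by_contra hcon
    rw [not_or, not_or] at hcon
    obtain ⟨hi, hii, hiii⟩ := hcon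
    have hone : ∀ u v, G.degree u = n - 1 → G.degree v = n - 1 → u = v := by
      intro u v hu hv
      by_contra huv
      have := SimpleGraph.degree_le_rd_of_forall_adj huv fun q _ hqv =>
        SimpleGraph.adj_of_degree_eq_card_sub_one (hn ▸ hv) hqv
      omega
    obtain ⟨v, hv⟩ := G.exists_maximal_degree_vertex
    have hmax : ∀ w, G.degree w ≤ G.degree v := fun w => hv ▸ G.degree_le_maxDegree w
    have hlt := hn ▸ G.degree_lt_card_verts v
    -- For `n = 2` the truncated bound `n - 3` would not contradict `rd G = n - 2`.
    have hn3 : 3 ≤ n := by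
      by_contra hlt3
      have : Nontrivial V := Fintype.one_lt_card_iff_nontrivial.1 (by omega)
      obtain ⟨w, hw⟩ := exists_ne v
      have h1 := hG.preconnected.degree_pos_of_nontrivial w
      have h2 := hmax w
      exact hw (hone w v (by omega) (by omega))
    by_cases hk : ∀ w, w ≠ v → G.degree w ≤ n - 3
    · have := hG.rd_le_of_degree_le hmax hk (by omega) (by omega)
      omega
    push Not at hk
    obtain ⟨w, hwv, hw⟩ := hk
    have hwle := hmax w
    have hw2 : G.degree w = n - 2 := by
      by_contra h
      exact hwv (hone w v (by omega) (by omega))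
    by_cases hv1 : G.degree v = n - 1
    · exact hi ⟨⟨v, hv1, fun u hu => hone u v hu hv1⟩, w, hw2⟩
    have hv2 : G.degree v = n - 2 := by omega
    have hadj : ∀ u v : V, u ≠ v → G.degree u = n - 2 → G.degree v = n - 2 → G.Adj u v := by
      intro a b hab ha hb
      by_contra h
      exact hii ⟨hv.trans hv2, a, b, hab, ha, hb, h⟩
    have hlast := SimpleGraph.rd_add_three_le_card hn (fun z => hv2 ▸ hmax z) hadj
      (by
        intro a b hab ha hb z
        by_contra hz
        exact hiii ⟨hv.trans hv2, hadj, Or.inl ⟨a, b, hab, ha, hb, z, hz⟩⟩)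
      (by
        intro a b hab ha hb x y hax hbx hby hay hr
        refine hiii ⟨hv.trans hv2, hadj, Or.inr ⟨a, b, hab, ha, hb, x, y, ?_, ⟨hax, ?_⟩,
          ⟨hby, ?_⟩, hr⟩⟩
        · rintro rfl
          exact hbx hby
        · rintro (h | h)
          · exact x.2 (Or.inr h)
          · exact hbx h
        · rintro (h | h)
          · exact y.2 (Or.inl h)
          · exact hay h)
      hwv hw2 hv2
    omega
  · intro h
    have hdegmax : G.maxDegree = n - 2 → ∀ u v, G.degree u = n - 1 → G.degree v = n - 1 → u = v := by
      intro hm u _ hu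
      have := G.degree_le_maxDegree u
      omega
    rcases h with ⟨⟨a, ha, huniq⟩, b, hb⟩ | ⟨hm, u, v, huv, hu, hv, hnadj⟩ |
      ⟨hm, hadj, ⟨u, v, huv, hu, hv, z, hz⟩ | ⟨u, v, huv, hu, hv, x, y, -, hx, hy, hxy⟩⟩
    · refine le_antisymm (hG.rd_le_card_sub_two hn hn2 fun u v hu hv =>
        (huniq u hu).trans (huniq v hv).symm) ?_
      have hba : b ≠ a := by
        rintro rfl
        have ha' : G.degree b = n - 1 := ha
        omega
      exact hb ▸ SimpleGraph.degree_le_rd_of_forall_adj hba fun q _ hqa =>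
        SimpleGraph.adj_of_degree_eq_card_sub_one (hn ▸ ha) hqa
    · refine le_antisymm (hG.rd_le_card_sub_two hn hn2 (hdegmax hm)) ?_
      exact hu ▸ SimpleGraph.degree_le_rd_of_forall_adj huv fun q huq hqv =>
        SimpleGraph.adj_of_degree_eq_card_sub_two (hn ▸ hv) huv (fun h => hnadj h.symm) hqv huq.ne'
    · refine le_antisymm (hG.rd_le_card_sub_two hn hn2 (hdegmax hm)) ?_
      have huz : ¬ G.Adj u z := fun h => hz (Or.inl h)
      have hvz : ¬ G.Adj v z := fun h => hz (Or.inr h)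
      have hzv : z ≠ v := fun h => huz (h ▸ hadj u v huv hu hv)
      exact hu ▸ SimpleGraph.degree_le_rd_of_forall_adj huv fun q huq hqv =>
        SimpleGraph.adj_of_degree_eq_card_sub_two (hn ▸ hv) hzv hvz hqv fun h => huz (h ▸ huq)
    · refine le_antisymm (hG.rd_le_card_sub_two hn hn2 (hdegmax hm)) ?_
      have hvx : ¬ G.Adj v x := fun h => hx.2 (Or.inr h)
      have huy : ¬ G.Adj u y := fun h => hy.2 (Or.inr h)
      exact hu ▸ SimpleGraph.degree_le_rd_of_reachable huv hx.1 hvx hy.1 huy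
        (fun q hqv hqx => SimpleGraph.adj_of_degree_eq_card_sub_two (hn ▸ hv)
          (fun h => x.2 (Or.inr h)) hvx hqv hqx) hxy
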